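/- Let $G$ be a finite group and let $V$ be a finite-dimensional $\mathbb{Q}[G]$-module. Let $\mathfrak{D}(G)$ be the set of $G$-invariant complex structures on $V\otimes_{\mathbb{Q}}\mathbb{R}$, that is, of real linear maps $J: V\otimes\mathbb{R}\to V\otimes\mathbb{R}$ with $J^2=-\mathrm{id}$ that commute with the action of $G$; it carries the subspace topology from the finite-dimensional real vector space $\mathrm{End}_{\mathbb{R}}(V\otimes\mathbb{R})$. A polarisation of $J$ with respect to a lattice $\Lambda$ in $V$ (a finitely generated subgroup that spans $V$ over $\mathbb{Q}$) is an alternating real bilinear form $\omega$ on $V\otimes\mathbb{R}$ such that $\omega(J\cdot,J\cdot)=\omega(\cdot,\cdot)$, the symmetric form $\omega(J\cdot,\cdot)$ is positive definite, and $\omega(\Lambda,\Lambda)\subseteq\mathbb{Z}$. Call $J$ polarisable if it has a polarisation with respect to every lattice in $V$ (equivalently, with respect to some lattice in $V$), and let $\mathfrak{D}(G)_p$ be the set of polarisable elements of $\mathfrak{D}(G)$. Then: 1. For every $J\in\mathfrak{D}(G)$ there is a continuous path $[0,1]\to\mathfrak{D}(G)$, $t\mapsto J_t$, with $J_0=J$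 and $J_1$ polarisable. 2. $\mathfrak{D}(G)_p$ is dense in $\mathfrak{D}(G)$. -/

import Mathlib

open scoped TensorProduct

namespace TorusQuotient

variable {G V : Type*} [Group G] [AddCommGroup V] [Module ℚ V]

/-- The canonical topology on the real vector space of endomorphisms of `V ⊗ ℝ`. When `V` is
finite-dimensional this is the unique Hausdorff vector space topology, i.e. the usual topology
on real square matrices. -/
noncomputable instance endTopology : TopologicalSpace (Module.End ℝ (ℝ ⊗[ℚ] V)) :=
  moduleTopology ℝ (Module.End ℝ (ℝ ⊗[ℚ] V))

/-- A complex structure on `V ⊗ ℝ`: a real linear `J` with `J² = -id`. -/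
def IsComplexStructure (J : Module.End ℝ (ℝ ⊗[ℚ] V)) : Prop :=
  ∀ x, J (J x) = -x

/-- `J` commutes with the action of `G` on `V ⊗ ℝ` obtained by extension of scalars. -/
def IsInvariant (ρ : Representation ℚ G V) (J : Module.End ℝ (ℝ ⊗[ℚ] V)) : Prop :=
  ∀ g x, (ρ g).baseChange ℝ (J x) = J ((ρ g).baseChange ℝ x)

/-- The set `𝔇(G)` of `G`-invariant complex structures on `V ⊗ ℝ`. As a type it carries the
subspace topology. -/
def invariantComplexStructures (ρ : Representation ℚ G V) :
    Set (Module.End ℝ (ℝ ⊗[ℚ] V)) :=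
  {J | IsComplexStructure J ∧ IsInvariant ρ J}

/-- A polarisation for `J` with respect to a lattice `Λ` in `V`: an alternating real two-form
`ω` on `V ⊗ ℝ` such that `ω(J·, J·) = ω`, the (automatically symmetric) form `ω(J·, ·)` is
positive definite, and `ω` takes integral values on `Λ`. -/
structure IsPolarisation (Λ : Submodule ℤ V) (J : Module.End ℝ (ℝ ⊗[ℚ] V))
    (ω : LinearMap.BilinForm ℝ (ℝ ⊗[ℚ] V)) : Prop where
  alt : ω.IsAlt
  compatible : ∀ x y, ω (J x) (J y) = ω x y
  pos : ∀ x, x ≠ 0 → 0 < ω (J x) x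
  integral : ∀ u ∈ Λ, ∀ v ∈ Λ, ∃ n : ℤ, ω (1 ⊗ₜ u) (1 ⊗ₜ v) = n

/-- `J` is polarisable: it has a polarisation with respect to every lattice of `V` (a finitely
generated subgroup that spans `V` over `ℚ`). By `isPolarisable_of_isPolarisation` it suffices
to have a polarisation with respect to one lattice. -/
def IsPolarisable (J : Module.End ℝ (ℝ ⊗[ℚ] V)) : Prop :=
  ∀ Λ : Submodule ℤ V, Submodule.IsLattice ℚ Λ → ∃ ω, IsPolarisation Λ J ω

theorem exists_nat_smul_mem (Λ : Submodule ℤ V) (hΛ : Submodule.span ℚ (Λ : Set V) = ⊤)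
    (v : V) : ∃ m : ℕ, 0 < m ∧ m • v ∈ Λ := by
  have hv : v ∈ Submodule.span ℚ (Λ : Set V) := hΛ ▸ Submodule.mem_top
  induction hv using Submodule.span_induction with
  | mem x hx => exact ⟨1, one_pos, by simpa using hx⟩
  | zero => exact ⟨1, one_pos, by simp⟩
  | add x y _ _ hx hy =>
    obtain ⟨a, ha, hax⟩ := hx
    obtain ⟨b, hb, hby⟩ := hy
    refine ⟨a * b, Nat.mul_pos ha hb, ?_⟩
    rw [smul_add]
    refine Λ.add_mem ?_ ?_
    · rw [mul_comm, mul_smul]; exact Λ.smul_of_tower_mem b hax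
    · rw [mul_smul]; exact Λ.smul_of_tower_mem a hby
  | smul q x _ hx =>
    obtain ⟨a, ha, hax⟩ := hx
    refine ⟨q.den * a, Nat.mul_pos q.den_pos ha, ?_⟩
    have h : (q.den * a) • q • x = q.num • a • x := by
      rw [← Nat.cast_smul_eq_nsmul ℚ, ← Int.cast_smul_eq_zsmul ℚ, ← Nat.cast_smul_eq_nsmul ℚ a,
        smul_smul, smul_smul]
      congr 1
      have := Rat.den_mul_eq_num q
      push_cast
      linear_combination (a : ℚ) * this
    rw [h]
    exact Λ.smul_mem _ hax

theorem exists_nat_smul_le (Λ Λ' : Submodule ℤ V) (hΛ : Submodule.span ℚ (Λ : Set V) = ⊤)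
    (hΛ' : Λ'.FG) : ∃ m : ℕ, 0 < m ∧ ∀ v ∈ Λ', m • v ∈ Λ := by
  obtain ⟨S, rfl⟩ := hΛ'
  choose f hf hfm using exists_nat_smul_mem Λ hΛ
  refine ⟨∏ s ∈ S, f s, Finset.prod_pos fun s _ => hf s, fun v hv => ?_⟩
  induction hv using Submodule.span_induction with
  | mem x hx =>
    obtain ⟨c, hc⟩ := Finset.dvd_prod_of_mem f hx
    rw [hc, mul_comm, mul_smul]
    exact Λ.smul_of_tower_mem c (hfm x)
  | zero => simp
  | add x y _ _ hx hy => rw [smul_add]; exact Λ.add_mem hx hy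
  | smul n x _ hx => rw [smul_comm]; exact Λ.smul_mem _ hx

/-- Polarisability does not depend on the lattice. -/
theorem isPolarisable_of_isPolarisation (Λ : Submodule ℤ V) (hΛ : Submodule.IsLattice ℚ Λ)
    (J : Module.End ℝ (ℝ ⊗[ℚ] V)) (ω : LinearMap.BilinForm ℝ (ℝ ⊗[ℚ] V))
    (hω : IsPolarisation Λ J ω) : IsPolarisable J := by
  intro Λ' hΛ'
  obtain ⟨m, hm, h⟩ := exists_nat_smul_le Λ Λ' hΛ.span_eq_top hΛ'.fg
  have hm' : (0 : ℝ) < (m : ℝ) := Nat.cast_pos.mpr hm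
  refine ⟨((m : ℝ) * m) • ω, ?_, ?_, ?_, ?_⟩
  · intro x
    simp [hω.alt x]
  · intro x y
    simp [hω.compatible x y]
  · intro x hx
    have := hω.pos x hx
    simp only [LinearMap.smul_apply, smul_eq_mul]
    positivity
  · intro u hu v hv
    obtain ⟨n, hn⟩ := hω.integral _ (h u hu) _ (h v hv)
    refine ⟨n, ?_⟩
    rw [← hn, TensorProduct.tmul_smul, TensorProduct.tmul_smul]
    simp [mul_assoc]

end TorusQuotient

open Filter Topology

/-! ### Local openness of quadratic maps -/

section QuadraticMap

/-! Averaging an inner product over `G` gives an invariant alternating form `ω` compatible with `J`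
and positive. It need not be rational, so `J` is moved instead. For `g` commuting with `G`, the map
`g ↦ ω(g·, g·)` has derivative `X ↦ ω(X·, ·) + ω(·, X·)` at `1`. This is onto the invariant
alternating forms because `ω` is nondegenerate (`exists_commutingEnd_apply_eq`), so the map is open
at `1`. Rational forms are dense among the invariant alternating ones, so one of them equals `ω(g·,
g·)` with `g` near `1`. It polarises `g⁻¹Jg` after clearing denominators. Conjugating by `1 + t(g -
1)` gives the path, and `g → 1` gives density. -/

theorem map_bilin_diag_nhds_eq {E F : Type*} [NormedAddCommGroup E] [NormedSpace ℝ E]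
    [FiniteDimensional ℝ E] [NormedAddCommGroup F] [NormedSpace ℝ F] [FiniteDimensional ℝ F]
    (Q : E →ₗ[ℝ] E →ₗ[ℝ] F) (e : E) (h : ∀ η, ∃ x, Q e x + Q x e = η) :
    map (fun x => Q x x) (𝓝 e) = 𝓝 (Q e e) := by
  have : CompleteSpace E := FiniteDimensional.complete ℝ E
  have : CompleteSpace F := FiniteDimensional.complete ℝ F
  let B : E →L[ℝ] E →L[ℝ] F :=
    LinearMap.toContinuousLinearMap (LinearMap.toContinuousLinearMap.toLinearMap ∘ₗ Q)
  have hB := B.hasStrictFDerivAt_of_bilinear (hasStrictFDerivAt_id (𝕜 := ℝ) e)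
    (hasStrictFDerivAt_id (𝕜 := ℝ) e)
  refine hB.map_nhds_eq_of_surj (LinearMap.range_eq_top.2 fun η => ?_)
  obtain ⟨x, hx⟩ := h η
  exact ⟨x, by simpa [B] using hx⟩

/-- The diagonal values over `S` fill a neighbourhood of `Q e e`, which the dense set `T '' D` must
meet. Coordinates `φ` supply the norm, as `F` has no topology. -/
theorem exists_bilin_diag_mem_image_dense {E F ι : Type*} [NormedAddCommGroup E] [NormedSpace ℝ E]
    [FiniteDimensional ℝ E] [AddCommMonoid F] [Module ℝ F] [Finite ι]
    (Q : E →ₗ[ℝ] E →ₗ[ℝ] F) (e : E) (h : ∀ η, ∃ x, Q e x + Q x e = η)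
    (T : (ι → ℝ) →ₗ[ℝ] F) (hT : Function.Surjective T) {D : Set (ι → ℝ)} (hD : Dense D)
    {S : Set E} (hS : S ∈ 𝓝 e) : ∃ x ∈ S, ∃ d ∈ D, T d = Q x x := by
  cases nonempty_fintype ι
  let : AddCommGroup F := Module.addCommMonoidToAddCommGroup ℝ
  have : Module.Finite ℝ F := Module.Finite.of_surjective T hT
  let φ := (Module.finBasis ℝ F).equivFun
  have hQ := map_bilin_diag_nhds_eq (Q.compr₂ φ.toLinearMap) e fun η => by
    obtain ⟨x, hx⟩ := h (φ.symm η)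
    refine ⟨x, ?_⟩
    rw [LinearMap.compr₂_apply, LinearMap.compr₂_apply, ← map_add, hx]
    simp
  have hd : Dense ((φ.toLinearMap ∘ₗ T) '' D) :=
    (φ.surjective.comp hT).denseRange.dense_image
      (φ.toLinearMap ∘ₗ T).continuous_of_finiteDimensional hD
  have hm := image_mem_map (m := fun x => Q.compr₂ φ.toLinearMap x x) hS
  rw [hQ] at hm
  obtain ⟨_, ⟨d, hd, rfl⟩, x, hx, hdx⟩ := hd.inter_nhds_nonempty hm
  exact ⟨x, hx, d, hd, φ.injective (by simpa using hdx.symm)⟩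

end QuadraticMap

/-! ### Continuity of inversion -/

section Inverse

variable {W : Type*} [AddCommGroup W] [Module ℝ W] [FiniteDimensional ℝ W]
  [TopologicalSpace (Module.End ℝ W)] [IsModuleTopology ℝ (Module.End ℝ W)]

theorem Module.End.continuousAt_ringInverse_and_eventually_isUnit (g : Module.End ℝ W) (hg : IsUnit g) :
    ContinuousAt Ring.inverse g ∧ ∀ᶠ f in 𝓝 g, IsUnit f := by
  let e := LinearMap.toMatrixAlgEquiv (Module.finBasis ℝ W)
  have hu : ∀ f, IsUnit f ↔ IsUnit (e f).det := fun f => by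
    rw [← Matrix.isUnit_iff_isUnit_det, MulEquiv.isUnit_map]
  have he : Continuous e := IsModuleTopology.continuous_of_linearMap e.toLinearMap
  have : ContinuousAdd (Module.End ℝ W) := IsModuleTopology.toContinuousAdd ℝ _
  have : IsTopologicalAddGroup (Module.End ℝ W) := IsModuleTopology.topologicalAddGroup ℝ _
  have hs : Continuous e.symm := e.symm.toLinearMap.continuous_of_finiteDimensional
  -- Holds at non-units too, since both inverses are then zero.
  have hi : ∀ f, Ring.inverse f = e.symm (e f)⁻¹ := fun f => by
    by_cases hf : IsUnit f
    · apply hf.mul_left_cancel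
      rw [Ring.mul_inverse_cancel _ hf]
      apply e.injective
      rw [map_mul, e.apply_symm_apply, Matrix.mul_nonsing_inv _ ((hu f).1 hf), map_one]
    · rw [Ring.inverse_non_unit _ hf, Matrix.nonsing_inv_apply_not_isUnit _ (mt (hu f).2 hf),
        map_zero]
  refine ⟨?_, ?_⟩
  · rw [funext hi]
    refine hs.continuousAt.comp (ContinuousAt.comp (g := fun A => A⁻¹) ?_ he.continuousAt)
    refine continuousAt_matrix_inv _ ?_
    rw [Ring.inverse_eq_inv']
    exact continuousAt_inv₀ ((hu g).1 hg).ne_zero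
  · simp only [hu, isUnit_iff_ne_zero]
    exact (he.matrix_det.continuousAt).eventually_ne ((hu g).1 hg).ne_zero

end Inverse

/-! ### Deforming the complex structure by conjugation -/

section Deformation

variable {G W : Type*} [AddCommGroup W] [Module ℝ W]

/-- The endomorphisms that commute with every `σ g`. -/
def commutingEnd (σ : G → Module.End ℝ W) : Submodule ℝ (Module.End ℝ W) where
  carrier := {X | ∀ g, Commute (σ g) X}
  add_mem' hX hY g := (hX g).add_right (hY g)
  zero_mem' _ := Commute.zero_right _
  smul_mem' c _ hX g := (hX g).smul_right c

/-- The alternating bilinear forms that are preserved by every `σ g`. -/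
def invariantAltForms (σ : G → Module.End ℝ W) : Submodule ℝ (LinearMap.BilinForm ℝ W) where
  carrier := {η | η.IsAlt ∧ ∀ g x y, η (σ g x) (σ g y) = η x y}
  add_mem' hη hθ := ⟨hη.1.add hθ.1, fun g x y => by simp [hη.2, hθ.2]⟩
  zero_mem' := ⟨LinearMap.BilinForm.isAlt_zero, fun g x y => by simp⟩
  smul_mem' c _ hη := ⟨hη.1.smul c, fun g x y => by simp [hη.2]⟩

variable [FiniteDimensional ℝ W]

/-- Nondegeneracy lets `ω` represent `η` by a unique endomorphism; invariance of both forms makes it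
commute with the action. -/
theorem exists_commutingEnd_apply_eq {σ : G → Module.End ℝ W}
    (hσ : ∀ g, Function.Surjective (σ g)) {ω η : LinearMap.BilinForm ℝ W}
    (hω : ω ∈ invariantAltForms σ) (hnd : ω.Nondegenerate) (hη : η ∈ invariantAltForms σ) :
    ∃ X ∈ commutingEnd σ, ∀ x y, ω (X x) y = η x y := by
  have hX : ∀ x y, ω (η.symmCompOfNondegenerate ω hnd x) y = η x y :=
    fun x y => LinearMap.BilinForm.symmCompOfNondegenerate_left_apply η hnd y x
  refine ⟨_, fun g => ?_, hX⟩
  refine LinearMap.ext fun x => LinearMap.ker_eq_bot.1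
    (LinearMap.separatingLeft_iff_ker_eq_bot.1 hnd.1) (LinearMap.ext fun y => ?_)
  obtain ⟨y, rfl⟩ := hσ g y
  rw [Module.End.mul_apply, Module.End.mul_apply, hω.2, hX, hX, hη.2]

variable [TopologicalSpace (Module.End ℝ W)] [IsModuleTopology ℝ (Module.End ℝ W)]

theorem exists_path_of_dense_invariantAltForms {ι : Type*} [Finite ι] {σ : G → Module.End ℝ W}
    (hσ : ∀ g, Function.Surjective (σ g))
    (P : LinearMap.BilinForm ℝ W →ₗ[ℝ] invariantAltForms σ)
    (hP : ∀ η : invariantAltForms σ, P η = η)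
    (T : (ι → ℝ) →ₗ[ℝ] invariantAltForms σ) (hT : Function.Surjective T)
    {D : Set (ι → ℝ)} (hD : Dense D)
    {J : Module.End ℝ W} (hJ : ∀ x, J (J x) = -x) (hJσ : ∀ g, Commute (σ g) J)
    {ω : LinearMap.BilinForm ℝ W} (hω : ω ∈ invariantAltForms σ)
    (hωJ : ∀ x y, ω (J x) (J y) = ω x y) (hpos : ∀ x, x ≠ 0 → 0 < ω (J x) x)
    {U : Set (Module.End ℝ W)} (hU : U ∈ 𝓝 J) :
    ∃ γ : C(unitInterval, Module.End ℝ W),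
      (∀ t, (∀ x, γ t (γ t x) = -x) ∧ ∀ g, Commute (σ g) (γ t)) ∧ γ 0 = J ∧ γ 1 ∈ U ∧
      ∃ d ∈ D, (∀ x y, (T d).1 (γ 1 x) (γ 1 y) = (T d).1 x y) ∧
        ∀ x, x ≠ 0 → 0 < (T d).1 (γ 1 x) x := by
  have hR : IsTopologicalRing (Module.End ℝ W) := IsModuleTopology.isTopologicalRing ℝ _
  have hnd : ω.Nondegenerate := by
    refine ⟨fun x hx => ?_, fun x hx => ?_⟩ <;> by_contra h0
    · have := hpos x h0
      rw [← hωJ, hJ] at this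
      simp [hx] at this
    · exact (hpos x h0).ne' (hx _)
  let c := (Module.finBasis ℝ (commutingEnd σ)).equivFun.symm
  let L : (Fin (Module.finrank ℝ (commutingEnd σ)) → ℝ) →ₗ[ℝ] Module.End ℝ W :=
    (commutingEnd σ).subtype ∘ₗ c.toLinearMap
  have hLσ : ∀ x, L x ∈ commutingEnd σ := fun x => (c x).2
  have hLc : Continuous L := L.continuous_of_finiteDimensional
  have hLs : ∀ X ∈ commutingEnd σ, ∃ x, L x = X := fun X hX => by
    obtain ⟨x, hx⟩ := c.surjective ⟨X, hX⟩
    exact ⟨x, congrArg Subtype.val hx⟩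
  obtain ⟨e, he⟩ := hLs 1 fun g => Commute.one_right _
  -- Off the diagonal the pullback need not be alternating, hence the projection `P`; on the
  -- diagonal `P` changes nothing.
  let Q := LinearMap.mk₂ ℝ (fun x y => P (ω.compl₁₂ (L x) (L y)))
    (fun x x' y => by rw [← map_add]; congr 1; ext; simp)
    (fun r x y => by rw [← map_smul]; congr 1; ext; simp)
    (fun x y y' => by rw [← map_add]; congr 1; ext; simp)
    (fun r x y => by rw [← map_smul]; congr 1; ext; simp)
  have hQ : ∀ η, ∃ x, Q e x + Q x e = η := fun η => by
    -- The factor `1 / 2` is there because, by antisymmetry, `ω(X·, ·)` and `ω(·, X·)` contribute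
    -- equally.
    obtain ⟨X, hX, h⟩ := exists_commutingEnd_apply_eq hσ hω hnd
      ((invariantAltForms σ).smul_mem (1 / 2) η.2)
    obtain ⟨x, rfl⟩ := hLs X hX
    refine ⟨x, ?_⟩
    rw [← hP η, LinearMap.mk₂_apply, LinearMap.mk₂_apply, ← map_add]
    congr 1
    ext u v
    have h1 := h u v
    have h2 := h v u
    rw [← LinearMap.IsAlt.neg hω.1] at h2
    have h3 := LinearMap.IsAlt.neg η.2.1 v u
    simp only [LinearMap.smul_apply, smul_eq_mul] at h1 h2
    simp only [he, LinearMap.add_apply, LinearMap.compl₁₂_apply, Module.End.one_apply]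
    linarith
  let K : Module.End ℝ W → Module.End ℝ W := fun g => Ring.inverse g * J * g
  have hK : ∀ g, IsUnit g → ContinuousAt K g := fun g hg =>
    ((Module.End.continuousAt_ringInverse_and_eventually_isUnit g hg).1.mul continuousAt_const).mul continuousAt_id
  -- Compactness of the interval keeps the whole segment from `1` to `L x` invertible for `x` near
  -- `e`.
  have hseg : ∀ᶠ x in 𝓝 e, ∀ t ∈ (Set.univ : Set unitInterval),
      IsUnit (L (e + (t : ℝ) • (x - e))) := by
    refine isCompact_univ.eventually_forall_of_forall_eventually fun t _ => ?_
    have hc : Continuous fun z : (Fin (Module.finrank ℝ (commutingEnd σ)) → ℝ) × unitInterval =>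
      L (e + (z.2 : ℝ) • (z.1 - e)) := hLc.comp (by fun_prop)
    refine hc.continuousAt.eventually (p := IsUnit) ?_
    refine (Module.End.continuousAt_ringInverse_and_eventually_isUnit _ ?_).2
    simp [he]
  have hUe : ∀ᶠ x in 𝓝 e, K (L x) ∈ U := by
    refine (ContinuousAt.comp (g := K) (hK _ ?_) hLc.continuousAt).eventually_mem ?_
    · simp [he]
    · simpa [he, K] using hU
  obtain ⟨x, ⟨hxs, hxU⟩, d, hd, hdx⟩ :=
    exists_bilin_diag_mem_image_dense Q e hQ T hT hD (hseg.and hUe)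
  have hgσ : ∀ g, g ∈ commutingEnd σ → ∀ s y, σ s (g y) = g (σ s y) :=
    fun g hg s y => LinearMap.congr_fun (hg s) y
  have hTd : ∀ y z, (T d).1 y z = ω (L x y) (L x z) := by
    have hmem : ω.compl₁₂ (L x) (L x) ∈ invariantAltForms σ :=
      ⟨fun y => hω.1 _, fun s y z => by
        rw [LinearMap.compl₁₂_apply, LinearMap.compl₁₂_apply, ← hgσ _ (hLσ x), ← hgσ _ (hLσ x),
          hω.2]⟩
    have : T d = ⟨_, hmem⟩ := hdx.trans (hP ⟨_, hmem⟩)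
    intro y z
    rw [this]
    rfl
  have hgK : ∀ g : Module.End ℝ W, IsUnit g → ∀ y, g (K g y) = J (g y) := fun g hg y => by
    rw [← Module.End.mul_apply, ← mul_assoc, ← mul_assoc, Ring.mul_inverse_cancel _ hg, one_mul,
      Module.End.mul_apply]
  have hinj : ∀ g : Module.End ℝ W, IsUnit g → Function.Injective g :=
    fun g hg => ((Module.End.isUnit_iff g).1 hg).1
  have hx1 : IsUnit (L x) := by simpa using hxs 1 trivial
  have h1 : K (L (e + ((1 : unitInterval) : ℝ) • (x - e))) = K (L x) := by simp
  refine ⟨⟨fun t => K (L (e + (t : ℝ) • (x - e))), continuous_iff_continuousAt.2 fun t =>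
    ContinuousAt.comp (g := K) (hK _ (hxs t trivial))
      (hLc.comp (by fun_prop)).continuousAt⟩, fun t => ⟨fun y => ?_, fun s => ?_⟩, ?_, ?_, d, hd,
      fun y z => ?_, fun y hy => ?_⟩
  · apply hinj _ (hxs t trivial)
    simp only [ContinuousMap.coe_mk, hgK _ (hxs t trivial), hJ, map_neg]
  · refine LinearMap.ext fun y => hinj _ (hxs t trivial) ?_
    simp only [ContinuousMap.coe_mk, Module.End.mul_apply]
    rw [← hgσ _ (hLσ _), hgK _ (hxs t trivial), hgK _ (hxs t trivial), ← hgσ _ (hLσ _)]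
    exact LinearMap.congr_fun (hJσ s) _
  · simp [K, he]
  · simpa using hxU
  · simp only [ContinuousMap.coe_mk, h1]
    rw [hTd, hTd, hgK _ hx1, hgK _ hx1, hωJ]
  · simp only [ContinuousMap.coe_mk, h1]
    rw [hTd, hgK _ hx1]
    exact hpos _ fun h => hy (hinj _ hx1 (h.trans (map_zero _).symm))

end Deformation

/-! ### Averaging over the group -/

section Averaging

variable {G W : Type*} [Group G] [Fintype G] [AddCommGroup W] [Module ℝ W]

theorem exists_invariant_posDef [FiniteDimensional ℝ W] (σ : Representation ℝ G W) :
    ∃ h : LinearMap.BilinForm ℝ W, (∀ x y, h x y = h y x) ∧ (∀ x, x ≠ 0 → 0 < h x x) ∧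
      ∀ g x y, h (σ g x) (σ g y) = h x y := by
  let b := Module.finBasis ℝ W
  let h₀ : LinearMap.BilinForm ℝ W := Matrix.toBilin b 1
  have h₀_apply : ∀ x y, h₀ x y = ∑ i, b.repr x i * b.repr y i := fun x y => by
    simp [h₀, Matrix.toBilin_apply, Matrix.one_apply]
  have h₀_nonneg : ∀ x, 0 ≤ h₀ x x := fun x => by
    rw [h₀_apply]
    exact Finset.sum_nonneg fun i _ => mul_self_nonneg _
  have h₀_pos : ∀ x, x ≠ 0 → 0 < h₀ x x := fun x hx => by
    refine (h₀_nonneg x).lt_of_ne' fun h => hx (b.ext_elem fun i => ?_)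
    rw [h₀_apply, Finset.sum_eq_zero_iff_of_nonneg fun i _ => mul_self_nonneg _] at h
    simpa using h i (Finset.mem_univ i)
  let h : LinearMap.BilinForm ℝ W := ∑ g, h₀.compl₁₂ (σ g) (σ g)
  have h_apply : ∀ x y, h x y = ∑ g, h₀ (σ g x) (σ g y) := fun x y => by
    simp [h, LinearMap.sum_apply]
  refine ⟨h, fun x y => ?_, fun x hx => ?_, fun g x y => ?_⟩
  · simp only [h_apply, h₀_apply, mul_comm]
  · rw [h_apply]
    refine Finset.sum_pos' (fun g _ => h₀_nonneg _) ⟨1, Finset.mem_univ _, ?_⟩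
    simpa using h₀_pos x hx
  · simp only [h_apply, ← Module.End.mul_apply, ← map_mul]
    exact Fintype.sum_equiv (Equiv.mulRight g) _ _ fun _ => rfl

theorem exists_compatible_invariantAltForm [FiniteDimensional ℝ W] (σ : Representation ℝ G W)
    {J : Module.End ℝ W} (hJ : ∀ x, J (J x) = -x) (hJσ : ∀ g, Commute (σ g) J) :
    ∃ ω ∈ invariantAltForms σ, (∀ x y, ω (J x) (J y) = ω x y) ∧
      ∀ x, x ≠ 0 → 0 < ω (J x) x := by
  obtain ⟨h, hsymm, hpos, hinv⟩ := exists_invariant_posDef σ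
  have hJσ' : ∀ g x, J (σ g x) = σ g (J x) := fun g x => (LinearMap.congr_fun (hJσ g) x).symm
  -- Then `ω(Jx, x) = h(Jx, Jx) + h(x, x)`, so `h` need not be `J`-invariant.
  refine ⟨h.compl₁₂ LinearMap.id J - h.compl₁₂ J LinearMap.id, ⟨fun x => ?_, fun g x y => ?_⟩,
    fun x y => ?_, fun x hx => ?_⟩
  · simp [hsymm x]
  · simp [hJσ', hinv]
  · simp only [LinearMap.sub_apply, LinearMap.compl₁₂_apply, LinearMap.id_apply, hJ, map_neg,
      LinearMap.neg_apply]
    ring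
  · have hJx : J x ≠ 0 := fun h0 => hx (by simpa [h0] using (hJ x).symm)
    simp only [LinearMap.sub_apply, LinearMap.compl₁₂_apply, LinearMap.id_apply, hJ, map_neg,
      LinearMap.neg_apply, sub_neg_eq_add]
    exact add_pos (hpos _ hJx) (hpos _ hx)

/-- Averaging over the group and antisymmetrising projects the bilinear forms onto the invariant
alternating ones. -/
noncomputable def altAverage (σ : Representation ℝ G W) :
    LinearMap.BilinForm ℝ W →ₗ[ℝ] invariantAltForms σ where
  toFun η := ⟨(2 * Fintype.card G : ℝ)⁻¹ •
      ∑ g, (η.compl₁₂ (σ g) (σ g) - η.flip.compl₁₂ (σ g) (σ g)),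
    ⟨fun x => by simp [LinearMap.sum_apply], fun g x y => by
      simp only [LinearMap.smul_apply, LinearMap.sum_apply, LinearMap.sub_apply,
        LinearMap.compl₁₂_apply, ← Module.End.mul_apply, ← map_mul]
      congr 1
      exact Fintype.sum_equiv (Equiv.mulRight g) _ _ fun _ => rfl⟩⟩
  map_add' η θ := by
    ext x y
    simp [LinearMap.sum_apply, Finset.sum_add_distrib]
    ring
  map_smul' c η := by
    ext x y
    simp [LinearMap.sum_apply, ← Finset.mul_sum]
    ring

theorem altAverage_apply (σ : Representation ℝ G W) (η : LinearMap.BilinForm ℝ W) (x y : W) :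
    (altAverage σ η).1 x y = (2 * Fintype.card G : ℝ)⁻¹ *
      ∑ g, (η (σ g x) (σ g y) - η (σ g y) (σ g x)) := by
  simp [altAverage, LinearMap.sum_apply]

theorem altAverage_coe (σ : Representation ℝ G W) (η : invariantAltForms σ) :
    altAverage σ η = η := by
  ext x y
  have h : ∀ g, η.1 (σ g x) (σ g y) - η.1 (σ g y) (σ g x) = 2 * η.1 x y := fun g => by
    rw [η.2.2, η.2.2, ← LinearMap.IsAlt.neg η.2.1 x y]
    ring
  rw [altAverage_apply]
  simp only [h, Finset.sum_const, Finset.card_univ, nsmul_eq_mul]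
  have : (Fintype.card G : ℝ) ≠ 0 := by simp
  field_simp

end Averaging

/-! ### Rational forms and polarisations -/

section Rational

variable {V : Type*} [AddCommGroup V] [Module ℚ V]

/-- The bilinear forms on `V ⊗ ℝ` that take rational values on `V`. -/
def IsRationalForm (η : LinearMap.BilinForm ℝ (ℝ ⊗[ℚ] V)) : Prop :=
  ∀ u v : V, η (1 ⊗ₜ u) (1 ⊗ₜ v) ∈ (algebraMap ℚ ℝ).range

theorem isRationalForm_toBilin {ι : Type*} [Fintype ι] [DecidableEq ι] (b : Module.Basis ι ℚ V)
    (M : Matrix ι ι ℝ) (hM : ∀ i j, M i j ∈ (algebraMap ℚ ℝ).range) :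
    IsRationalForm (Matrix.toBilin (b.baseChange ℝ) M) := fun u v => by
  rw [Matrix.toBilin_apply]
  refine Subring.sum_mem _ fun i _ => Subring.sum_mem _ fun j _ =>
    Subring.mul_mem _ (Subring.mul_mem _ ?_ (hM i j)) ?_
  · exact ⟨b.repr u i, by simp [Algebra.smul_def]⟩
  · exact ⟨b.repr v j, by simp [Algebra.smul_def]⟩

/-- The representation on `V ⊗ ℝ` obtained from `ρ` by extension of scalars. -/
noncomputable def realification {G : Type*} [Group G] (ρ : Representation ℚ G V) :
    Representation ℝ G (ℝ ⊗[ℚ] V) :=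
  (Module.End.baseChangeHom ℚ ℝ V : Module.End ℚ V →* Module.End ℝ (ℝ ⊗[ℚ] V)).comp ρ

theorem realification_apply {G : Type*} [Group G] (ρ : Representation ℚ G V) (g : G) :
    realification ρ g = (ρ g).baseChange ℝ := rfl

theorem IsRationalForm.altAverage {G : Type*} [Group G] [Fintype G] (ρ : Representation ℚ G V)
    {η : LinearMap.BilinForm ℝ (ℝ ⊗[ℚ] V)} (hη : IsRationalForm η) :
    IsRationalForm (altAverage (realification ρ) η).1 := fun u v => by
  rw [altAverage_apply]
  refine Subring.mul_mem _ ⟨(2 * Fintype.card G)⁻¹, by simp⟩ (Subring.sum_mem _ fun g _ => ?_)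
  simp only [realification_apply, LinearMap.baseChange_tmul]
  exact Subring.sub_mem _ (hη _ _) (hη _ _)

/-- `N` is the product of the denominators over all pairs of generators; bilinearity does the rest.
-/
theorem IsRationalForm.exists_nat_mul_integral {η : LinearMap.BilinForm ℝ (ℝ ⊗[ℚ] V)}
    (hη : IsRationalForm η) {Λ : Submodule ℤ V} (hΛ : Λ.FG) :
    ∃ N : ℕ, 0 < N ∧ ∀ u ∈ Λ, ∀ v ∈ Λ, ∃ n : ℤ, (N : ℝ) * η (1 ⊗ₜ u) (1 ⊗ₜ v) = n := by
  obtain ⟨S, rfl⟩ := hΛ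
  choose q hq using hη
  let f : V × V → ℕ := fun p => (q p.1 p.2).den
  let N := ∏ p ∈ S ×ˢ S, f p
  refine ⟨N, Finset.prod_pos fun p _ => (q p.1 p.2).den_pos, fun u hu v hv => ?_⟩
  induction hu, hv using Submodule.span_induction₂ with
  | mem_mem u v hu hv =>
    obtain ⟨c, hc⟩ := Finset.dvd_prod_of_mem f (Finset.mk_mem_product hu hv)
    refine ⟨c * (q u v).num, ?_⟩
    have h : (((q u v).den : ℚ) : ℝ) * (q u v : ℝ) = ((q u v).num : ℚ) := by
      exact_mod_cast Rat.den_mul_eq_num (q u v)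
    have hN : (N : ℝ) = (q u v).den * c := by exact_mod_cast hc
    rw [← hq, hN, eq_ratCast]
    push_cast at h ⊢
    linear_combination (c : ℝ) * h
  | zero_left v _ => exact ⟨0, by simp⟩
  | zero_right u _ => exact ⟨0, by simp⟩
  | add_left x y z _ _ _ hx hy =>
    obtain ⟨⟨m, hm⟩, n, hn⟩ := And.intro hx hy
    exact ⟨m + n, by simp [TensorProduct.tmul_add, mul_add, hm, hn]⟩
  | add_right x y z _ _ _ hx hy =>
    obtain ⟨⟨m, hm⟩, n, hn⟩ := And.intro hx hy
    exact ⟨m + n, by simp [TensorProduct.tmul_add, mul_add, hm, hn]⟩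
  | smul_left r x y _ _ h =>
    obtain ⟨m, hm⟩ := h
    refine ⟨r * m, ?_⟩
    rw [TensorProduct.tmul_smul, map_zsmul, LinearMap.smul_apply, zsmul_eq_mul]
    push_cast
    rw [← hm]
    ring
  | smul_right r x y _ _ h =>
    obtain ⟨m, hm⟩ := h
    refine ⟨r * m, ?_⟩
    rw [TensorProduct.tmul_smul, map_zsmul, zsmul_eq_mul]
    push_cast
    rw [← hm]
    ring

theorem isPolarisable_of_isRationalForm {J : Module.End ℝ (ℝ ⊗[ℚ] V)}
    {η : LinearMap.BilinForm ℝ (ℝ ⊗[ℚ] V)} (hη : IsRationalForm η) (halt : η.IsAlt)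
    (hηJ : ∀ x y, η (J x) (J y) = η x y) (hpos : ∀ x, x ≠ 0 → 0 < η (J x) x) :
    TorusQuotient.IsPolarisable J := fun Λ hΛ => by
  obtain ⟨N, hN, h⟩ := hη.exists_nat_mul_integral hΛ.fg
  refine ⟨(N : ℝ) • η, halt.smul _, fun x y => ?_, fun x hx => ?_, fun u hu v hv => ?_⟩
  · simp [hηJ]
  · exact mul_pos (Nat.cast_pos.2 hN) (hpos x hx)
  · exact h u hu v hv

end Rational

/-! ### Paths to polarisable structures -/

theorem exists_path_to_polarisable {G V : Type*} [Group G] [Finite G] [AddCommGroup V]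
    [Module ℚ V] [FiniteDimensional ℚ V] (ρ : Representation ℚ G V)
    (J : TorusQuotient.invariantComplexStructures ρ)
    {U : Set (TorusQuotient.invariantComplexStructures ρ)} (hU : U ∈ 𝓝 J) :
    ∃ γ : C(unitInterval, TorusQuotient.invariantComplexStructures ρ),
      γ 0 = J ∧ TorusQuotient.IsPolarisable (γ 1).1 ∧ γ 1 ∈ U := by
  cases nonempty_fintype G
  have : IsModuleTopology ℝ (Module.End ℝ (ℝ ⊗[ℚ] V)) := ⟨rfl⟩
  obtain ⟨U', hU', hUU'⟩ := mem_nhds_subtype _ _ _ |>.1 hU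
  let σ := realification ρ
  let b := Module.finBasis ℚ V
  -- Matrix entries in a rational basis parametrise the invariant forms, and rational entries, which
  -- are dense, yield rational forms.
  let T := altAverage σ ∘ₗ (Matrix.toBilin (b.baseChange ℝ)).toLinearMap ∘ₗ
    (LinearEquiv.curry ℝ ℝ _ _).toLinearMap
  have hT : Function.Surjective T := fun η => by
    obtain ⟨c, hc⟩ := ((LinearEquiv.curry ℝ ℝ _ _).trans
      (Matrix.toBilin (b.baseChange ℝ))).surjective η.1
    refine ⟨c, ?_⟩
    rw [← altAverage_coe σ η, ← hc]
    rfl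
  have hJσ : ∀ g, Commute (σ g) J.1 := fun g => LinearMap.ext fun x => J.2.2 g x
  obtain ⟨ω, hω, hωJ, hpos⟩ := exists_compatible_invariantAltForm σ J.2.1 hJσ
  obtain ⟨γ, hγ, hγ0, hγU, d, hd, hdJ, hdpos⟩ := exists_path_of_dense_invariantAltForms
    (fun g => ((Module.End.isUnit_iff _).1 ((Group.isUnit g).map σ)).2) (altAverage σ)
    (altAverage_coe σ) T hT (dense_pi Set.univ fun _ _ => Rat.denseRange_cast (𝕜 := ℝ))
    J.2.1 hJσ hω hωJ hpos hU'
  refine ⟨⟨fun t => ⟨γ t, (hγ t).1, fun g x => LinearMap.congr_fun ((hγ t).2 g) x⟩,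
    γ.continuous.subtype_mk _⟩, Subtype.ext hγ0, ?_, hUU' hγU⟩
  refine isPolarisable_of_isRationalForm (η := (T d).1) ?_ (T d).2.1 hdJ hdpos
  exact (isRationalForm_toBilin b _ fun i j => hd (i, j) trivial).altAverage ρ

theorem mainTheorem6 {G V : Type*} [Group G] [Finite G] [AddCommGroup V] [Module ℚ V]
    [FiniteDimensional ℚ V] (ρ : Representation ℚ G V) :
    (∀ J : TorusQuotient.invariantComplexStructures ρ,
      ∃ γ : C(unitInterval, TorusQuotient.invariantComplexStructures ρ),
        γ 0 = J ∧ TorusQuotient.IsPolarisable (γ 1).1) ∧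
    Dense {J : TorusQuotient.invariantComplexStructures ρ |
      TorusQuotient.IsPolarisable J.1} := by
  refine ⟨fun J => ?_, fun J => mem_closure_iff_nhds.2 fun U hU => ?_⟩
  · obtain ⟨γ, h0, h1, -⟩ := exists_path_to_polarisable ρ J univ_mem
    exact ⟨γ, h0, h1⟩
  · obtain ⟨γ, -, h1, hγ⟩ := exists_path_to_polarisable ρ J hU
    exact ⟨γ 1, hγ, h1⟩
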